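/- Let $D\ge 0$ be an even integer and $F=\mathbb Z/2$. Let $\mathcal I^1_D$ be the set of integer intervals $[a,b]$ with $1\le a\le b\le D$ and $a\equiv b \pmod 2$; put $\kappa([a,b])=0$ if $a,b$ are even and $\kappa([a,b])=1$ if $a,b$ are odd. Write $[a,b]\prec[a',b']$ if $a'<a\le b<b'$. Let $S_D$ be the set of all subsets $B\subset\mathcal I^1_D$ such that (P$_0$) for $I=[a,b]$ and $I'=[a',b']$ in $B$, either $I=I'$, or $a'-b\ge 2$, or $a-b'\ge 2$, or $I\prec I'$, or $I'\prec I$; (P$_1$) for $I=[a,b]\in B$ and $x\in I$ with $x\equiv a+1\pmod 2$ there is $I'\in B$ with $x\in I'$ and $I'\prec I$. For $B\in S_D$ let ${}^1B$ be obtained from $B$ by removing every $I\in B$ with $\kappa(I)=0$ which is contained in no other element of $B$. Let $V_D$ be the $F$-vector space with basis $e_1,\dots,e_D$ and with the bilinear form $(e_i,e_j)=1$ if $i-j=\pm1$, $(e_i,e_j)=0$ otherwise. Let $V_D^0$ (resp. $V_D^1$) be the span of the $e_j$ with $j$ even (resp. odd). For $B\in S_D$ let $\langle B\rangle$ be the span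 of the vectors $\sum_{j\in I}e_j$ $(I\in B)$, and let $\langle B\rangle_\delta=\langle B\rangle\cap V_D^\delta$ for $\delta\in\{0,1\}$. For a subspace $\mathcal L\subset V_D^\delta$ let $\mathcal L^!=\{x\in V_D^{1-\delta}:(x,\mathcal L)=0\}$. Let $\mathcal C(V_D^1)$ be the set of subspaces of the form $\langle B\rangle_1$ with $B\in S_D$, and let $\mathcal A(V_D^1)$ be the set of pairs $(\mathcal L,\mathcal L')\in\mathcal C(V_D^1)\times\mathcal C(V_D^1)$ such that $\mathcal L\subset\mathcal L'$ (equality allowed) and $\mathcal L\oplus\mathcal L'^!=\langle B\rangle$ for some $B\in S_D$. Then for every $\mathcal L\in\mathcal C(V_D^1)$ the following hold. (e) The set $\{\mathcal L'\in\mathcal C(V_D^1):(\mathcal L,\mathcal L')\in\mathcal A(V_D^1)\}$ contains a unique $\mathcal L'$ with $|\mathcal L'|$ maximal. (f) The set $\{B'\in S_D:\langle B'\rangle_1=\mathcal L\}$ contains a unique $B'$ with $|\langle B'\rangle_0^!|$ maximal, and a unique $B'$ with $\dim\langle B'\rangle_0$ minimal. In both cases $B'={}^1B$, where $B$ is any element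 of $S_D$ with $\langle B\rangle_1=\mathcal L$. -/

import Mathlib

namespace AlmostSpecial

/-- An interval `[a, b]` of natural numbers, given by its pair of end points. -/
abbrev Interval := ℕ × ℕ

/-- The set of integers `z` with `a ≤ z ≤ b`. -/
def Interval.pts (I : Interval) : Finset ℕ := Finset.Icc I.1 I.2

/-- `𝓘¹_D`: the intervals `[a, b]` with `1 ≤ a ≤ b ≤ D` and `a = b mod 2`. -/
def intervals (D : ℕ) : Set Interval :=
  {I | 1 ≤ I.1 ∧ I.1 ≤ I.2 ∧ I.2 ≤ D ∧ I.1 ≡ I.2 [MOD 2]}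

/-- `[a, b] ≺ [a', b']`: `a' < a` and `b < b'`. -/
def Prec (I I' : Interval) : Prop := I'.1 < I.1 ∧ I.2 < I'.2

/-- `[a, b] ♠ [a', b']`: `a' - b ≥ 2` or `a - b' ≥ 2` (differences taken in `ℤ`). -/
def Apart (I I' : Interval) : Prop := I.2 + 2 ≤ I'.1 ∨ I'.2 + 2 ≤ I.1

/-- `κ([a, b])`: it is `0` if `a, b` are even and `1` if `a, b` are odd. -/
def kappa (I : Interval) : ZMod 2 := (I.1 : ZMod 2)

/-- `I^{ev}`: the points `x` of `I = [a, b]` with `x = a + 1 mod 2`. -/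
def Interval.ev (I : Interval) : Finset ℕ := I.pts.filter fun x => x ≡ I.1 + 1 [MOD 2]

/-- `S_D`: the sets `B` of intervals in `𝓘¹_D` with the properties `(P₀)` and `(P₁)`. -/
def S (D : ℕ) : Set (Finset Interval) :=
  {B | (∀ I ∈ B, I ∈ intervals D) ∧
    (∀ I ∈ B, ∀ I' ∈ B, I = I' ∨ Apart I I' ∨ Prec I I' ∨ Prec I' I) ∧
    (∀ I ∈ B, ∀ x ∈ I.ev, ∃ I' ∈ B, x ∈ I'.pts ∧ Prec I' I)}

/-- `m_{I,B} = |{I' ∈ B : I ⊆ I'}|`. -/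
def mult (I : Interval) (B : Finset Interval) : ℕ :=
  (B.filter fun I' => I.pts ⊆ I'.pts).card

/-- `¹B = B - {I ∈ B : κ(I) = 0, m_{I,B} = 1}`. -/
def one (B : Finset Interval) : Finset Interval :=
  B.filter fun I => ¬ (kappa I = 0 ∧ mult I B = 1)

/-- The vector space `V_D` over `F = ℤ/2` of functions on `{1, …, D}`. -/
abbrev V (D : ℕ) := Finset.Icc 1 D → ZMod 2

/-- The basis vectors `e_1, …, e_D` of `V_D`. -/
def e (D : ℕ) (j : Finset.Icc 1 D) : V D := Pi.single j 1

/-- `e_J = ∑_{j ∈ J} e_j` for `J ⊆ {1, …, D}`. -/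
def eSum (D : ℕ) (J : Finset ℕ) : V D :=
  ∑ j : Finset.Icc 1 D, if (j : ℕ) ∈ J then e D j else 0

/-- The symplectic form on `V_D`: `(e_i, e_j) = 1` if `i - j = ±1`, and `0` otherwise. -/
noncomputable def form (D : ℕ) : LinearMap.BilinForm (ZMod 2) (V D) :=
  Matrix.toBilin' (Matrix.of fun i j : Finset.Icc 1 D =>
    if (i : ℕ) + 1 = j ∨ (j : ℕ) + 1 = i then (1 : ZMod 2) else 0)

/-- `V_D^δ`: the span of the `e_j` with `j = δ mod 2`. -/
def Vpart (D : ℕ) (δ : ZMod 2) : Submodule (ZMod 2) (V D) :=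
  Submodule.span (ZMod 2) {x | ∃ j : Finset.Icc 1 D, ((j : ℕ) : ZMod 2) = δ ∧ x = e D j}

/-- `⟨B⟩`: the span of the `e_I`, `I ∈ B`. -/
def spanB (D : ℕ) (B : Finset Interval) : Submodule (ZMod 2) (V D) :=
  Submodule.span (ZMod 2) {x | ∃ I ∈ B, x = eSum D I.pts}

/-- `⟨B⟩_δ = ⟨B⟩ ∩ V_D^δ`. -/
def part (D : ℕ) (δ : ZMod 2) (B : Finset Interval) : Submodule (ZMod 2) (V D) :=
  spanB D B ⊓ Vpart D δ

/-- `𝓛^! = {x ∈ V_D^{1-δ} : (x, 𝓛) = 0}`, for a subspace `𝓛` of `V_D^δ`. -/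
noncomputable def shriek (D : ℕ) (δ : ZMod 2) (L : Submodule (ZMod 2) (V D)) :
    Submodule (ZMod 2) (V D) where
  carrier := {x | x ∈ Vpart D (1 - δ) ∧ ∀ y ∈ L, form D x y = 0}
  zero_mem' := ⟨Submodule.zero_mem _, fun y _ => by simp⟩
  add_mem' := fun {x x'} hx hx' =>
    ⟨Submodule.add_mem _ hx.1 hx'.1, fun y hy => by simp [hx.2 y hy, hx'.2 y hy]⟩
  smul_mem' := fun c x hx =>
    ⟨Submodule.smul_mem _ c hx.1, fun y hy => by simp [hx.2 y hy]⟩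

/-- `𝓒(V_D^δ)`: the subspaces of the form `⟨B⟩_δ` for some `B ∈ S_D`. -/
def C (D : ℕ) (δ : ZMod 2) : Set (Submodule (ZMod 2) (V D)) :=
  {L | ∃ B ∈ S D, L = part D δ B}

/-- `𝓐(V_D^1)`: the pairs `(𝓛, 𝓛')` in `𝓒(V_D^1) × 𝓒(V_D^1)` with `𝓛 ⊆ 𝓛'` and
`𝓛 ⊕ 𝓛'^! = ⟨B⟩` for some `B ∈ S_D`; the sum is direct because `𝓛 ⊆ V_D^1` and
`𝓛'^! ⊆ V_D^0`. -/
def A (D : ℕ) : Set (Submodule (ZMod 2) (V D) × Submodule (ZMod 2) (V D)) :=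
  {p | p.1 ∈ C D 1 ∧ p.2 ∈ C D 1 ∧ p.1 ≤ p.2 ∧ ∃ B ∈ S D, p.1 ⊔ shriek D 1 p.2 = spanB D B}

/-- The set of `B' ∈ S_D` with `⟨B'⟩_1 = 𝓛`. -/
def fibre (D : ℕ) (L : Submodule (ZMod 2) (V D)) : Set (Finset Interval) :=
  {B' | B' ∈ S D ∧ part D 1 B' = L}

end AlmostSpecial

namespace AlmostSpecial

/-! By (P₀), `B` is a laminar family, so its union is partitioned into blocks `own B I`: the points
of `I` in no smaller interval of `B`. By (P₁) every point of a block has the parity of the end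
points of `I`. Hence `⟨B⟩` has the block indicators as a basis, and `⟨B⟩_δ` is spanned by the blocks
of parity `δ`.

Consequently `⟨B⟩_δ` determines the intervals of parity `δ` together with their blocks
(`mem_and_own_eq_of_part_eq`). The odd blocks moreover determine every even interval lying strictly
inside another interval, since it is exactly a gap in the block of its odd parent
(`mem_of_part_one_eq`). So `¹B` depends only on `⟨B⟩_1 = 𝓛` and lies in every member of the fibre
over `𝓛`: its even part is the least one in the fibre (`part_zero_one_le`). This gives (f), because
`𝓛 ↦ 𝓛^!` reverses inclusions and is involutive for even `D`.

For (e), every pair `(𝓛, 𝓛')` in `𝓐` has `𝓛' = ⟨B⟩_0^!` with `B` in the fibre (`part_eq_of_mem_A`),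
so the largest candidate is `⟨¹B⟩_0^!`. That it belongs to `𝓒` is seen by adding single odd points
to `¹B` until the span is Lagrangian, without changing the even part. -/

variable {D : ℕ} {B B' : Finset Interval} {I J K : Interval} {x y : ℕ} {δ : ZMod 2}

/-! ### Blocks of a laminar family of intervals -/

open Classical in
/-- The points of `I` which lie in no interval `J ∈ B` with `J ≺ I`. -/
noncomputable def own (B : Finset Interval) (I : Interval) : Finset ℕ :=
  I.pts.filter fun x => ∀ J ∈ B, Prec J I → x ∉ J.pts

theorem mem_pts : x ∈ I.pts ↔ I.1 ≤ x ∧ x ≤ I.2 := Finset.mem_Icc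

theorem mem_own : x ∈ own B I ↔ x ∈ I.pts ∧ ∀ J ∈ B, Prec J I → x ∉ J.pts := by
  simp [own]

theorem Prec.trans (h : Prec I J) (h' : Prec J K) : Prec I K :=
  ⟨h'.1.trans h.1, h.2.trans h'.2⟩

theorem Prec.pts_subset (h : Prec I J) : I.pts ⊆ J.pts :=
  Finset.Icc_subset_Icc h.1.le h.2.le

theorem natCast_eq_natCast_iff_mod : ((x : ℕ) : ZMod 2) = y ↔ x % 2 = y % 2 :=
  ZMod.natCast_eq_natCast_iff x y 2

theorem bounds_of_mem (hB : B ∈ S D) (hI : I ∈ B) :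
    1 ≤ I.1 ∧ I.1 ≤ I.2 ∧ I.2 ≤ D ∧ I.1 % 2 = I.2 % 2 := hB.1 I hI

theorem left_mem_own (hB : B ∈ S D) (hI : I ∈ B) : I.1 ∈ own B I := by
  have := bounds_of_mem hB hI
  refine mem_own.2 ⟨mem_pts.2 (by omega), fun J _ hJ h => ?_⟩
  have := mem_pts.1 h
  have := hJ.1
  omega

theorem right_mem_own (hB : B ∈ S D) (hI : I ∈ B) : I.2 ∈ own B I := by
  have := bounds_of_mem hB hI
  refine mem_own.2 ⟨mem_pts.2 (by omega), fun J _ hJ h => ?_⟩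
  have := mem_pts.1 h
  have := hJ.2
  omega

theorem eq_of_mem_own (hB : B ∈ S D) (hI : I ∈ B) (hJ : J ∈ B) (hx : x ∈ own B I)
    (hx' : x ∈ own B J) : I = J := by
  rw [mem_own] at hx hx'
  rcases hB.2.1 I hI J hJ with h | h | h | h
  · exact h
  · have h1 := mem_pts.1 hx.1
    have h2 := mem_pts.1 hx'.1
    rcases h with h | h <;> omega
  · exact absurd hx.1 (hx'.2 I hI h)
  · exact absurd hx'.1 (hx.2 J hJ h)

/-- Descending through ever shorter intervals that contain `x` must stop at one whose block contains
`x`. With `eq_of_mem_own`, the blocks partition the union of `B`. -/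
theorem exists_mem_own (hI : I ∈ B) (hx : x ∈ I.pts) :
    ∃ J ∈ B, (J = I ∨ Prec J I) ∧ x ∈ own B J := by
  induction hn : I.2 - I.1 using Nat.strong_induction_on generalizing I with
  | _ n ih =>
    by_cases h : x ∈ own B I
    · exact ⟨I, hI, Or.inl rfl, h⟩
    · rw [mem_own] at h
      push Not at h
      obtain ⟨J, hJ, hJI, hxJ⟩ := h hx
      have h1 := mem_pts.1 hxJ
      have h2 := hJI.1
      have h3 := hJI.2
      obtain ⟨K, hK, hKJ, hxK⟩ := ih (J.2 - J.1) (by omega) hJ hxJ rfl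
      refine ⟨K, hK, Or.inr ?_, hxK⟩
      rcases hKJ with rfl | hKJ
      · exact hJI
      · exact hKJ.trans hJI

/-- This is (P₁) in terms of blocks: a point of the wrong parity is covered by a smaller interval.
-/
theorem mod_two_of_mem_own (hB : B ∈ S D) (hI : I ∈ B) (hx : x ∈ own B I) :
    x % 2 = I.1 % 2 := by
  rw [mem_own] at hx
  by_contra h
  have hev : x ∈ I.ev := by
    refine Finset.mem_filter.2 ⟨hx.1, ?_⟩
    change x % 2 = (I.1 + 1) % 2
    omega
  obtain ⟨J, hJ, hxJ, hJI⟩ := hB.2.2 I hI x hev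
  exact hx.2 J hJ hJI hxJ

theorem own_subset_or_disjoint (hB : B ∈ S D) (hI : I ∈ B) (hJ : J ∈ B) (hx : x ∈ own B J)
    (hy : y ∈ own B J) (hxI : x ∈ I.pts) : y ∈ I.pts := by
  have h1 := mem_pts.1 hxI
  rw [mem_own] at hx hy
  rcases hB.2.1 I hI J hJ with rfl | h | h | h
  · exact hy.1
  · have h2 := mem_pts.1 hx.1
    rcases h with h | h <;> omega
  · exact absurd hxI (hx.2 I hI h)
  · exact h.pts_subset hy.1

theorem own_eq_of_subset (hBB : B ⊆ B') (h : ∀ J ∈ B', Prec J I → J ∈ B) :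
    own B I = own B' I := by
  ext x
  simp only [mem_own]
  exact and_congr_right fun _ =>
    ⟨fun hx J hJ hJI => hx J (h J hJ hJI) hJI, fun hx J hJ => hx J (hBB hJ)⟩

/-! ### The spaces `⟨B⟩` and `⟨B⟩_δ` -/

theorem eSum_apply (s : Finset ℕ) (i : Finset.Icc 1 D) :
    eSum D s i = if (i : ℕ) ∈ s then 1 else 0 := by
  simp only [eSum, Finset.sum_apply]
  rw [Finset.sum_eq_single i]
  · split_ifs <;> simp [e]
  · intro j _ hj
    split_ifs <;> simp [e, hj.symm]
  · simp

theorem mem_Vpart {v : V D} : v ∈ Vpart D δ ↔ ∀ i, v i ≠ 0 → ((i : ℕ) : ZMod 2) = δ := by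
  constructor
  · intro hv
    induction hv using Submodule.span_induction with
    | mem v hv =>
      obtain ⟨j, hj, rfl⟩ := hv
      intro i hi
      by_cases h : i = j
      · rw [h, hj]
      · exact absurd (by simp [e, h]) hi
    | zero => simp
    | add v w _ _ hv hw =>
      intro i hi
      by_cases h : v i = 0
      · exact hw i fun h' => hi (by simp [h, h'])
      · exact hv i h
    | smul c v _ hv => exact fun i hi => hv i fun h => hi (by simp [h])
  · intro h
    have hv : v = ∑ i, v i • e D i := by
      simpa [e] using (pi_eq_sum_univ' v)
    rw [hv]
    refine Submodule.sum_mem _ fun i _ => ?_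
    by_cases h0 : v i = 0
    · simp [h0]
    · exact Submodule.smul_mem _ _ (Submodule.subset_span ⟨i, h i h0, rfl⟩)

theorem eSum_pts_eq_sum_own (hB : B ∈ S D) (hI : I ∈ B) [DecidablePred fun J => Prec J I] :
    eSum D I.pts = eSum D (own B I) + ∑ J ∈ B with Prec J I, eSum D (own B J) := by
  ext i
  simp only [Pi.add_apply, Finset.sum_apply, eSum_apply]
  by_cases hi : (i : ℕ) ∈ I.pts
  · obtain ⟨J, hJ, hJI, hiJ⟩ := exists_mem_own hI hi
    rcases hJI with rfl | hJI
    · rw [Finset.sum_eq_zero, if_pos hi, if_pos hiJ, add_zero]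
      intro K hK
      rw [Finset.mem_filter] at hK
      refine if_neg fun h => ?_
      have := eq_of_mem_own hB hJ hK.1 hiJ h
      subst this
      exact lt_irrefl _ hK.2.1
    · rw [Finset.sum_eq_single J, if_pos hi, if_pos hiJ, if_neg, zero_add]
      · intro h
        exact (mem_own.1 h).2 J hJ hJI (mem_own.1 hiJ).1
      · intro K hK hKJ
        exact if_neg fun h => hKJ (eq_of_mem_own hB (Finset.mem_filter.1 hK).1 hJ h hiJ)
      · exact fun h => absurd (Finset.mem_filter.2 ⟨hJ, hJI⟩) h
  · rw [Finset.sum_eq_zero, if_neg hi, if_neg fun h => hi (mem_own.1 h).1, add_zero]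
    intro K hK
    exact if_neg fun h => hi ((Finset.mem_filter.1 hK).2.pts_subset (mem_own.1 h).1)

/-- The passage from intervals to blocks is unitriangular for `≺`, so it can be inverted by
induction on length. -/
theorem eSum_own_mem_spanB (hB : B ∈ S D) (hI : I ∈ B) : eSum D (own B I) ∈ spanB D B := by
  classical
  induction hn : I.2 - I.1 using Nat.strong_induction_on generalizing I with
  | _ n ih =>
    rw [eq_sub_of_add_eq (eSum_pts_eq_sum_own hB hI).symm]
    refine Submodule.sub_mem _ (Submodule.subset_span ⟨I, hI, rfl⟩)
      (Submodule.sum_mem _ fun J hJ => ?_)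
    rw [Finset.mem_filter] at hJ
    have h1 := hJ.2.1
    have h2 := hJ.2.2
    have := bounds_of_mem hB hJ.1
    exact ih (J.2 - J.1) (by omega) hJ.1 rfl

theorem mem_spanB (hB : B ∈ S D) {v : V D} :
    v ∈ spanB D B ↔
      (∀ I ∈ B, ∀ i j : Finset.Icc 1 D, (i : ℕ) ∈ own B I → (j : ℕ) ∈ own B I → v i = v j) ∧
      ∀ i, v i ≠ 0 → ∃ I ∈ B, (i : ℕ) ∈ own B I := by
  constructor
  · intro hv
    induction hv using Submodule.span_induction with
    | mem v hv =>
      obtain ⟨K, hK, rfl⟩ := hv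
      constructor
      · intro I hI i j hi hj
        rw [eSum_apply, eSum_apply]
        exact if_congr ⟨own_subset_or_disjoint hB hK hI hi hj,
          own_subset_or_disjoint hB hK hI hj hi⟩ rfl rfl
      · intro i hi
        have : (i : ℕ) ∈ K.pts := by
          by_contra h
          exact hi (by rw [eSum_apply, if_neg h])
        obtain ⟨J, hJ, -, h⟩ := exists_mem_own hK this
        exact ⟨J, hJ, h⟩
    | zero => simp
    | add v w _ _ hv hw =>
      refine ⟨fun I hI i j hi hj => ?_, fun i hi => ?_⟩
      · rw [Pi.add_apply, Pi.add_apply, hv.1 I hI i j hi hj, hw.1 I hI i j hi hj]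
      · by_cases h : v i = 0
        · exact hw.2 i fun h' => hi (by simp [h, h'])
        · exact hv.2 i h
    | smul c v _ hv =>
      refine ⟨fun I hI i j hi hj => ?_, fun i hi => hv.2 i fun h => hi (by simp [h])⟩
      rw [Pi.smul_apply, Pi.smul_apply, hv.1 I hI i j hi hj]
  · rintro ⟨h1, h2⟩
    have hmem : ∀ I : B, I.1.1 ∈ Finset.Icc 1 D := fun I => by
      have := bounds_of_mem hB I.2
      exact Finset.mem_Icc.2 (by omega)
    -- The coefficient of a block is the value of `v` at the left end point, which always belongs to
    -- the block.
    have hv : v = ∑ I : B, v ⟨I.1.1, hmem I⟩ • eSum D (own B I.1) := by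
      ext i
      simp only [Finset.sum_apply, Pi.smul_apply, eSum_apply, smul_eq_mul]
      by_cases hi : ∃ I ∈ B, (i : ℕ) ∈ own B I
      · obtain ⟨I, hI, hi⟩ := hi
        rw [Finset.sum_eq_single ⟨I, hI⟩]
        · rw [if_pos hi, mul_one]
          exact h1 I hI _ _ hi (left_mem_own hB hI)
        · intro J _ hJ
          rw [if_neg, mul_zero]
          exact fun h => hJ (Subtype.ext (eq_of_mem_own hB J.2 hI h hi))
        · simp
      · rw [Finset.sum_eq_zero]
        · by_contra h
          exact hi (h2 i h)
        · intro J _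
          rw [if_neg, mul_zero]
          exact fun h => hi ⟨J.1, J.2, h⟩
    rw [hv]
    exact Submodule.sum_mem _ fun I _ => Submodule.smul_mem _ _ (eSum_own_mem_spanB hB I.2)

theorem natCast_eq_kappa (hB : B ∈ S D) (hI : I ∈ B) (hx : x ∈ own B I) :
    (x : ZMod 2) = kappa I :=
  natCast_eq_natCast_iff_mod.2 (mod_two_of_mem_own hB hI hx)

theorem mem_part (hB : B ∈ S D) {v : V D} :
    v ∈ part D δ B ↔
      (∀ I ∈ B, kappa I = δ → ∀ i j : Finset.Icc 1 D, (i : ℕ) ∈ own B I → (j : ℕ) ∈ own B I →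
        v i = v j) ∧
      ∀ i, v i ≠ 0 → ∃ I ∈ B, kappa I = δ ∧ (i : ℕ) ∈ own B I := by
  rw [part, Submodule.mem_inf, mem_spanB hB, mem_Vpart]
  constructor
  · rintro ⟨⟨h1, h2⟩, h3⟩
    refine ⟨fun I hI _ => h1 I hI, fun i hi => ?_⟩
    obtain ⟨I, hI, h⟩ := h2 i hi
    exact ⟨I, hI, (natCast_eq_kappa hB hI h).symm.trans (h3 i hi), h⟩
  · rintro ⟨h1, h2⟩
    have h3 : ∀ i, v i ≠ 0 → ((i : ℕ) : ZMod 2) = δ := fun i hi => by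
      obtain ⟨I, hI, hδ, h⟩ := h2 i hi
      exact (natCast_eq_kappa hB hI h).trans hδ
    refine ⟨⟨fun I hI i j hi hj => ?_, fun i hi => ?_⟩, h3⟩
    · by_cases hδ : kappa I = δ
      · exact h1 I hI hδ i j hi hj
      · have h0 : ∀ k : Finset.Icc 1 D, (k : ℕ) ∈ own B I → v k = 0 := fun k hk => by
          by_contra h
          exact hδ ((natCast_eq_kappa hB hI hk).symm.trans (h3 k h))
        rw [h0 i hi, h0 j hj]
    · obtain ⟨I, hI, -, h⟩ := h2 i hi
      exact ⟨I, hI, h⟩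

theorem eSum_own_mem_part (hB : B ∈ S D) (hI : I ∈ B) :
    eSum D (own B I) ∈ part D (kappa I) B := by
  refine ⟨eSum_own_mem_spanB hB hI, mem_Vpart.2 fun i hi => ?_⟩
  by_cases h : (i : ℕ) ∈ own B I
  · exact natCast_eq_kappa hB hI h
  · exact absurd (by rw [eSum_apply, if_neg h]) hi

theorem part_congr (hB : B ∈ S D) (hB' : B' ∈ S D)
    (h : ∀ I, kappa I = δ → (I ∈ B ↔ I ∈ B'))
    (h' : ∀ I ∈ B, kappa I = δ → own B I = own B' I) : part D δ B = part D δ B' := by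
  ext v
  rw [mem_part hB, mem_part hB']
  constructor
  · rintro ⟨h1, h2⟩
    refine ⟨fun I hI hδ => ?_, fun i hi => ?_⟩
    · rw [← h' I ((h I hδ).2 hI) hδ]
      exact h1 I ((h I hδ).2 hI) hδ
    · obtain ⟨I, hI, hδ, hi⟩ := h2 i hi
      exact ⟨I, (h I hδ).1 hI, hδ, h' I hI hδ ▸ hi⟩
  · rintro ⟨h1, h2⟩
    refine ⟨fun I hI hδ => ?_, fun i hi => ?_⟩
    · rw [h' I hI hδ]
      exact h1 I ((h I hδ).1 hI) hδ
    · obtain ⟨I, hI, hδ, hi⟩ := h2 i hi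
      refine ⟨I, (h I hδ).2 hI, hδ, ?_⟩
      rwa [h' I ((h I hδ).2 hI) hδ]

theorem Vpart_zero_sup_Vpart_one : Vpart D 0 ⊔ Vpart D 1 = ⊤ := by
  refine eq_top_iff.2 fun v _ => ?_
  have hv : v = (fun i : Finset.Icc 1 D => if ((i : ℕ) : ZMod 2) = 0 then v i else 0) +
      fun i : Finset.Icc 1 D => if ((i : ℕ) : ZMod 2) = 0 then 0 else v i := by
    ext i
    by_cases h : ((i : ℕ) : ZMod 2) = 0 <;> simp [h]
  rw [hv]
  refine Submodule.add_mem_sup (mem_Vpart.2 fun i hi => ?_) (mem_Vpart.2 fun i hi => ?_)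
  · by_contra h
    exact hi (if_neg h)
  · by_contra h
    refine hi (if_pos ?_)
    revert h
    generalize ((i : ℕ) : ZMod 2) = t
    revert t
    decide

theorem eq_zero_or_one (t : ZMod 2) : t = 0 ∨ t = 1 := by
  revert t
  decide

theorem part_zero_sup_part_one (hB : B ∈ S D) : part D 0 B ⊔ part D 1 B = spanB D B := by
  classical
  refine le_antisymm (sup_le inf_le_left inf_le_left) ?_
  have hown : ∀ I ∈ B, eSum D (own B I) ∈ part D 0 B ⊔ part D 1 B := fun I hI => by
    have := eSum_own_mem_part hB hI
    rcases eq_zero_or_one (kappa I) with h | h <;> rw [h] at this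
    · exact Submodule.mem_sup_left this
    · exact Submodule.mem_sup_right this
  refine Submodule.span_le.2 ?_
  rintro _ ⟨I, hI, rfl⟩
  rw [eSum_pts_eq_sum_own hB hI]
  exact Submodule.add_mem _ (hown I hI)
    (Submodule.sum_mem _ fun J hJ => hown J (Finset.mem_filter.1 hJ).1)

theorem spanB_mono (h : B ⊆ B') : spanB D B ≤ spanB D B' :=
  Submodule.span_mono fun _ ⟨I, hI, hx⟩ => ⟨I, h hI, hx⟩

theorem card_le_finrank_spanB (hB : B ∈ S D) : B.card ≤ Module.finrank (ZMod 2) (spanB D B) := by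
  have hli : LinearIndependent (ZMod 2) fun I : B => eSum D (own B I.1) := by
    rw [Fintype.linearIndependent_iff]
    intro g hg I
    have hb := bounds_of_mem hB I.2
    have h := congrFun hg ⟨I.1.1, Finset.mem_Icc.2 (by omega)⟩
    simp only [Finset.sum_apply, Pi.smul_apply, eSum_apply, smul_eq_mul, Pi.zero_apply] at h
    rw [Finset.sum_eq_single I] at h
    · simpa [left_mem_own hB I.2] using h
    · intro J _ hJ
      rw [if_neg, mul_zero]
      exact fun h' => hJ (Subtype.ext (eq_of_mem_own hB J.2 I.2 h' (left_mem_own hB I.2)))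
    · simp
  rw [← Fintype.card_coe, ← finrank_span_eq_card hli]
  refine Submodule.finrank_mono (Submodule.span_le.2 ?_)
  rintro _ ⟨I, rfl⟩
  exact eSum_own_mem_spanB hB I.2

/-! ### What `⟨B⟩_δ` determines -/

/-- The indicator of a block of `B` lies in `⟨B'⟩_δ`, so it is constant on the blocks of `B'`, and
the block is a union of these. -/
theorem own_subset_of_part_le (hB : B ∈ S D) (hB' : B' ∈ S D)
    (h : part D δ B ≤ part D δ B') (hI : I ∈ B) (hδ : kappa I = δ) (hx : x ∈ own B I) :
    ∃ J ∈ B', kappa J = δ ∧ x ∈ own B' J ∧ own B' J ⊆ own B I := by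
  subst hδ
  have hm := (mem_part hB').1 (h (eSum_own_mem_part hB hI))
  have hmem : ∀ {C : Finset Interval} {K : Interval} {y : ℕ}, C ∈ S D → K ∈ C → y ∈ own C K →
      y ∈ Finset.Icc 1 D := fun hC hK hy => by
    have h1 := bounds_of_mem hC hK
    have h2 := mem_pts.1 (mem_own.1 hy).1
    exact Finset.mem_Icc.2 (by omega)
  have hx1 := hmem hB hI hx
  obtain ⟨J, hJ, hδ, hxJ⟩ := hm.2 ⟨x, hx1⟩ (by rw [eSum_apply, if_pos hx]; exact one_ne_zero)
  refine ⟨J, hJ, hδ, hxJ, fun y hy => ?_⟩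
  have := hm.1 J hJ hδ ⟨x, hx1⟩ ⟨y, hmem hB' hJ hy⟩ hxJ hy
  rw [eSum_apply, eSum_apply, if_pos hx] at this
  by_contra hy'
  exact one_ne_zero (this.trans (if_neg hy'))

theorem mem_and_own_eq_of_part_eq (hB : B ∈ S D) (hB' : B' ∈ S D)
    (h : part D δ B = part D δ B') (hI : I ∈ B) (hδ : kappa I = δ) :
    I ∈ B' ∧ own B I = own B' I := by
  obtain ⟨J, hJ, hJδ, hxJ, hsub⟩ :=
    own_subset_of_part_le hB hB' h.le hI hδ (left_mem_own hB hI)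
  obtain ⟨K, hK, -, hxK, hsub'⟩ := own_subset_of_part_le hB' hB h.ge hJ hJδ hxJ
  obtain rfl := eq_of_mem_own hB hI hK (left_mem_own hB hI) hxK
  have heq := hsub'.antisymm hsub
  have h1 := mem_pts.1 (mem_own.1 (heq ▸ left_mem_own hB hI)).1
  have h2 := mem_pts.1 (mem_own.1 (heq ▸ right_mem_own hB hI)).1
  have h3 := mem_pts.1 (mem_own.1 (heq.symm ▸ left_mem_own hB' hJ)).1
  have h4 := mem_pts.1 (mem_own.1 (heq.symm ▸ right_mem_own hB' hJ)).1
  obtain rfl : I = J := Prod.ext (by omega) (by omega)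
  exact ⟨hJ, heq⟩

/-- Shrink `J` to an immediate parent of `I`. By (P₀), no other child of it can touch a neighbour of
`I`, so both neighbours are in the parent's block. They are odd, hence so is the parent. -/
theorem exists_odd_parent (hB : B ∈ S D) (hI : I ∈ B) (hI0 : kappa I = 0) (hJ : J ∈ B)
    (hIJ : Prec I J) :
    ∃ K ∈ B, kappa K = 1 ∧ Prec I K ∧ I.1 - 1 ∈ own B K ∧ I.2 + 1 ∈ own B K := by
  have hbI := bounds_of_mem hB hI
  induction hn : J.2 - J.1 using Nat.strong_induction_on generalizing J with
  | _ n ih =>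
    have hbJ := bounds_of_mem hB hJ
    by_cases hex : ∃ K ∈ B, Prec I K ∧ Prec K J
    · obtain ⟨K, hK, hIK, hKJ⟩ := hex
      have hbK := bounds_of_mem hB hK
      have h1 := hKJ.1
      have h2 := hKJ.2
      exact ih (K.2 - K.1) (by omega) hK hIK rfl
    · have h1 := hIJ.1
      have h2 := hIJ.2
      have key : ∀ x, x ∈ J.pts → (x = I.1 - 1 ∨ x = I.2 + 1) → x ∈ own B J := by
        intro x hxJ hx
        refine mem_own.2 ⟨hxJ, fun K hK hKJ hxK => ?_⟩
        have h3 := mem_pts.1 hxK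
        rcases hB.2.1 K hK I hI with rfl | (h | h) | h | h
        · omega
        · omega
        · omega
        · have h4 := h.1
          have h5 := h.2
          omega
        · exact hex ⟨K, hK, h, hKJ⟩
      have hl : I.1 - 1 ∈ own B J := key _ (mem_pts.2 (by omega)) (Or.inl rfl)
      refine ⟨J, hJ, ?_, hIJ, hl, key _ (mem_pts.2 (by omega)) (Or.inr rfl)⟩
      have hp := mod_two_of_mem_own hB hJ hl
      have h0 : I.1 % 2 = 0 % 2 := natCast_eq_natCast_iff_mod.1 (by simpa [kappa] using hI0)
      have : ((J.1 : ℕ) : ZMod 2) = (1 : ℕ) := natCast_eq_natCast_iff_mod.2 (by omega)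
      simpa [kappa] using this

/-- The odd parent `K` and its block survive in `B'`, and `I` fills a gap of that block. In `B'` the
gap is covered by intervals inside it. By (P₀) two of them cannot be adjacent, so the one starting
at `I.1` must be all of `I`. -/
theorem mem_of_part_one_eq (hB : B ∈ S D) (hB' : B' ∈ S D) (h : part D 1 B = part D 1 B')
    (hI : I ∈ B) (hI0 : kappa I = 0) (hJ : J ∈ B) (hIJ : Prec I J) :
    I ∈ B' ∧ ∃ K ∈ B', Prec I K := by
  obtain ⟨K, hK, hK1, hIK, hl, hr⟩ := exists_odd_parent hB hI hI0 hJ hIJ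
  obtain ⟨hK', hown⟩ := mem_and_own_eq_of_part_eq hB hB' h hK hK1
  refine ⟨?_, K, hK', hIK⟩
  have hbI := bounds_of_mem hB hI
  have hin : ∀ x, x ∈ I.pts → ∃ M ∈ B', Prec M K ∧ x ∈ M.pts ∧ I.1 ≤ M.1 ∧ M.2 ≤ I.2 := by
    intro x hx
    have hx' : x ∉ own B' K := fun h => (mem_own.1 (hown ▸ h)).2 I hI hIK hx
    rw [mem_own] at hx'
    push Not at hx'
    obtain ⟨M, hM, hMK, hxM⟩ := hx' (hIK.pts_subset hx)
    have h1 := (mem_own.1 (hown ▸ hl)).2 M hM hMK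
    have h2 := (mem_own.1 (hown ▸ hr)).2 M hM hMK
    rw [mem_pts] at h1 h2 hx hxM
    exact ⟨M, hM, hMK, mem_pts.2 hxM, by omega, by omega⟩
  obtain ⟨M, hM, hMK, hxM, hM1, hM2⟩ := hin I.1 (mem_pts.2 (by omega))
  have hxM := mem_pts.1 hxM
  by_cases h2 : M.2 = I.2
  · rwa [show I = M from Prod.ext (by omega) h2.symm]
  · obtain ⟨N, hN, hNK, hxN, hN1, hN2⟩ := hin (M.2 + 1) (mem_pts.2 (by omega))
    have hxN := mem_pts.1 hxN
    rcases hB'.2.1 M hM N hN with rfl | (h | h) | h | h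
    · omega
    · omega
    · omega
    · have := h.1
      omega
    · have := h.2
      omega

/-! ### The set `¹B` -/

theorem mem_one (hB : B ∈ S D) :
    I ∈ one B ↔ I ∈ B ∧ (kappa I = 1 ∨ ∃ J ∈ B, Prec I J) := by
  rw [one, Finset.mem_filter]
  refine and_congr_right fun hI => ?_
  have hself : I ∈ B.filter fun I' => I.pts ⊆ I'.pts := Finset.mem_filter.2 ⟨hI, subset_rfl⟩
  have hmult : mult I B = 1 ↔ ¬ ∃ J ∈ B, Prec I J := by
    constructor
    · rintro h ⟨J, hJ, hIJ⟩
      have := Finset.card_le_one.1 (show (B.filter fun I' => I.pts ⊆ I'.pts).card ≤ 1 from h.le)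
        I hself J (Finset.mem_filter.2 ⟨hJ, hIJ.pts_subset⟩)
      subst this
      exact lt_irrefl _ hIJ.1
    · intro h
      refine Finset.card_eq_one.2 ⟨I, Finset.eq_singleton_iff_unique_mem.2 ⟨hself, ?_⟩⟩
      intro J hJ
      rw [Finset.mem_filter] at hJ
      have hb := bounds_of_mem hB hI
      have h1 := mem_pts.1 (hJ.2 (mem_pts.2 ⟨le_rfl, hb.2.1⟩))
      rcases hB.2.1 J hJ.1 I hI with rfl | (h' | h') | h' | h'
      · rfl
      · omega
      · omega
      · have := h'.1
        omega
      · exact absurd ⟨J, hJ.1, h'⟩ h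
  rw [hmult]
  rcases eq_zero_or_one (kappa I) with h | h <;> simp [h]

theorem one_subset (B : Finset Interval) : one B ⊆ B := Finset.filter_subset _ _

theorem mem_one_of_prec (hB : B ∈ S D) (hI : I ∈ B) (hJ : J ∈ B) (h : Prec I J) : I ∈ one B :=
  (mem_one hB).2 ⟨hI, Or.inr ⟨J, hJ, h⟩⟩

theorem one_mem_S (hB : B ∈ S D) : one B ∈ S D := by
  refine ⟨fun I hI => hB.1 I (one_subset B hI),
    fun I hI J hJ => hB.2.1 I (one_subset B hI) J (one_subset B hJ), fun I hI x hx => ?_⟩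
  obtain ⟨J, hJ, hxJ, hJI⟩ := hB.2.2 I (one_subset B hI) x hx
  exact ⟨J, mem_one_of_prec hB hJ (one_subset B hI) hJI, hxJ, hJI⟩

theorem part_one_one (hB : B ∈ S D) : part D 1 (one B) = part D 1 B := by
  refine part_congr (one_mem_S hB) hB (fun I hI => ?_) fun I hI _ => ?_
  · exact ⟨fun h => one_subset B h, fun h => (mem_one hB).2 ⟨h, Or.inl hI⟩⟩
  · exact own_eq_of_subset (one_subset B) fun J hJ => mem_one_of_prec hB hJ (one_subset B hI)

theorem one_subset_one (hB : B ∈ S D) (hB' : B' ∈ S D) (h : part D 1 B = part D 1 B') :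
    one B ⊆ one B' := by
  intro I hI
  rw [mem_one hB] at hI
  rw [mem_one hB']
  rcases eq_zero_or_one (kappa I) with h0 | h1
  · obtain ⟨hI, h' | ⟨J, hJ, hIJ⟩⟩ := hI
    · exact absurd (h0.symm.trans h') (by decide)
    · have := mem_of_part_one_eq hB hB' h hI h0 hJ hIJ
      exact ⟨this.1, Or.inr this.2⟩
  · exact ⟨(mem_and_own_eq_of_part_eq hB hB' h hI.1 h1).1, Or.inl h1⟩

theorem one_eq_one (hB : B ∈ S D) (hB' : B' ∈ S D) (h : part D 1 B = part D 1 B') :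
    one B = one B' :=
  (one_subset_one hB hB' h).antisymm (one_subset_one hB' hB h.symm)

theorem eq_of_part_eq (hB : B ∈ S D) (hB' : B' ∈ S D) (h0 : part D 0 B = part D 0 B')
    (h1 : part D 1 B = part D 1 B') : B = B' := by
  ext I
  rcases eq_zero_or_one (kappa I) with h | h
  · exact ⟨fun hI => (mem_and_own_eq_of_part_eq hB hB' h0 hI h).1,
      fun hI => (mem_and_own_eq_of_part_eq hB' hB h0.symm hI h).1⟩
  · exact ⟨fun hI => (mem_and_own_eq_of_part_eq hB hB' h1 hI h).1,
      fun hI => (mem_and_own_eq_of_part_eq hB' hB h1.symm hI h).1⟩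

/-- The extremal property behind all the claims: `¹B = ¹B' ⊆ B'`. -/
theorem part_zero_one_le (hB : B ∈ S D) (hB' : B' ∈ S D) (h : part D 1 B = part D 1 B') :
    part D 0 (one B) ≤ part D 0 B' := by
  rw [one_eq_one hB hB' h]
  exact inf_le_inf_right _ (spanB_mono (one_subset B'))

/-! ### The completion of `¹B` by single odd points -/

open Classical in
/-- `B` together with the intervals `[j, j]`, `j` odd, for `j` in no interval of `B`. -/
noncomputable def completion (D : ℕ) (B : Finset Interval) : Finset Interval :=
  B ∪ ((Finset.Icc 1 D).filter fun j => j % 2 = 1 ∧ ∀ I ∈ B, j ∉ I.pts).image fun j => (j, j)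

theorem mem_completion : I ∈ completion D B ↔
    I ∈ B ∨ ∃ j, 1 ≤ j ∧ j ≤ D ∧ j % 2 = 1 ∧ (∀ I ∈ B, j ∉ I.pts) ∧ I = (j, j) := by
  simp only [completion, Finset.mem_union, Finset.mem_image, Finset.mem_filter, Finset.mem_Icc]
  refine or_congr_right ⟨?_, ?_⟩
  · rintro ⟨j, ⟨⟨h1, h2⟩, h3, h4⟩, rfl⟩
    exact ⟨j, h1, h2, h3, h4, rfl⟩
  · rintro ⟨j, h1, h2, h3, h4, rfl⟩
    exact ⟨j, ⟨⟨h1, h2⟩, h3, h4⟩, rfl⟩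

theorem subset_completion : B ⊆ completion D B := Finset.subset_union_left

theorem mem_of_mem_completion_of_prec (hI : I ∈ B) (hJ : J ∈ completion D B)
    (h : Prec J I) : J ∈ B := by
  rcases mem_completion.1 hJ with hJ | ⟨j, -, -, -, hj, rfl⟩
  · exact hJ
  · exact absurd (mem_pts.2 ⟨h.1.le, h.2.le⟩) (hj I hI)

/-- An uncovered odd `j` must not be adjacent to an interval of `B`. For an odd interval this is
parity; for any other, `j` also misses a strictly larger interval, which leaves distance at least 2.
-/
theorem completion_mem_S (hB : B ∈ S D) (h1 : ∀ I ∈ B, kappa I = 1 ∨ ∃ J ∈ B, Prec I J) :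
    completion D B ∈ S D := by
  have hapart : ∀ I ∈ B, ∀ j, 1 ≤ j → j % 2 = 1 → (∀ I ∈ B, j ∉ I.pts) → Apart I (j, j) := by
    intro I hI j hj1 hjo hj
    have hb := bounds_of_mem hB hI
    have hjI := hj I hI
    rw [mem_pts] at hjI
    unfold Apart
    rcases h1 I hI with h | ⟨J, hJ, h⟩
    · have : I.1 % 2 = 1 % 2 := natCast_eq_natCast_iff_mod.1 (by simpa [kappa] using h)
      dsimp only
      omega
    · have hjJ := hj J hJ
      rw [mem_pts] at hjJ
      have h1 := h.1
      have h2 := h.2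
      dsimp only
      omega
  refine ⟨fun I hI => ?_, fun I hI J hJ => ?_, fun I hI x hx => ?_⟩
  · rcases mem_completion.1 hI with hI | ⟨j, hj1, hjD, -, -, rfl⟩
    · exact hB.1 I hI
    · exact ⟨hj1, le_rfl, hjD, rfl⟩
  · rcases mem_completion.1 hI with hI | ⟨j, hj1, hjD, hjo, hj, rfl⟩ <;>
      rcases mem_completion.1 hJ with hJ | ⟨k, hk1, hkD, hko, hk, rfl⟩
    · exact hB.2.1 I hI J hJ
    · exact Or.inr (Or.inl (hapart I hI k hk1 hko hk))
    · exact Or.inr (Or.inl (hapart J hJ j hj1 hjo hj).symm)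
    · by_cases hjk : j = k
      · exact Or.inl (by rw [hjk])
      · refine Or.inr (Or.inl ?_)
        unfold Apart
        dsimp only
        omega
  · rcases mem_completion.1 hI with hI | ⟨j, -, -, -, -, rfl⟩
    · obtain ⟨J, hJ, h⟩ := hB.2.2 I hI x hx
      exact ⟨J, subset_completion hJ, h⟩
    · rw [Interval.ev, Finset.mem_filter, mem_pts] at hx
      have h2 : x % 2 = (j + 1) % 2 := hx.2
      have := hx.1
      dsimp only at this
      omega

theorem part_zero_completion (hB : B ∈ S D) (hC : completion D B ∈ S D) :
    part D 0 (completion D B) = part D 0 B := by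
  refine (part_congr hB hC (fun I hI => ⟨fun h => subset_completion h, fun h => ?_⟩)
    fun I hI _ => ?_).symm
  · rcases mem_completion.1 h with h | ⟨j, -, -, hjo, -, rfl⟩
    · exact h
    · have : j % 2 = 0 % 2 := natCast_eq_natCast_iff_mod.1 (by simpa [kappa] using hI)
      omega
  · exact own_eq_of_subset subset_completion fun J hJ =>
      mem_of_mem_completion_of_prec hI hJ

/-- Each even number `2k + 2 ≤ D` is charged to an interval. Let `J` own `2k + 1`, so `J` is odd.
Either `J` ends there, or `2k + 2` has the wrong parity for the block of `J` and a smaller interval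
starts at it. -/
theorem card_completion (hC : completion D B ∈ S D) : D / 2 ≤ (completion D B).card := by
  have hsub : (Finset.range (D / 2)).image (fun k => 2 * k + 2) ⊆
      (completion D B).image fun K => if K.1 % 2 = 1 then K.2 + 1 else K.1 := by
    intro i hi
    obtain ⟨k, hk, rfl⟩ := Finset.mem_image.1 hi
    rw [Finset.mem_range] at hk
    have hcov : ∃ K ∈ completion D B, 2 * k + 1 ∈ K.pts := by
      by_cases h : ∃ K ∈ B, 2 * k + 1 ∈ K.pts
      · obtain ⟨K, hK, h⟩ := h
        exact ⟨K, subset_completion hK, h⟩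
      · push Not at h
        exact ⟨(2 * k + 1, 2 * k + 1),
          mem_completion.2 (Or.inr ⟨2 * k + 1, by omega, by omega, by omega, h, rfl⟩),
          mem_pts.2 ⟨le_rfl, le_rfl⟩⟩
    obtain ⟨K, hK, hx⟩ := hcov
    obtain ⟨J, hJ, -, hx⟩ := exists_mem_own hK hx
    have hpar := mod_two_of_mem_own hC hJ hx
    have hb := bounds_of_mem hC hJ
    have hxJ := mem_pts.1 (mem_own.1 hx).1
    by_cases hend : J.2 = 2 * k + 1
    · exact Finset.mem_image.2 ⟨J, hJ, by rw [if_pos (by omega), hend]⟩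
    · have hnot : 2 * k + 2 ∉ own (completion D B) J := fun h => by
        have := mod_two_of_mem_own hC hJ h
        omega
      rw [mem_own] at hnot
      push Not at hnot
      obtain ⟨M, hM, hMJ, hxM⟩ := hnot (mem_pts.2 (by omega))
      have h1 := (mem_own.1 hx).2 M hM hMJ
      rw [mem_pts] at h1 hxM
      have : M.1 = 2 * k + 2 := by omega
      exact Finset.mem_image.2 ⟨M, hM, by rw [if_neg (by omega), this]⟩
  calc D / 2 = ((Finset.range (D / 2)).image fun k => 2 * k + 2).card := by
        rw [Finset.card_image_of_injective _ (fun a b h => by simpa using h), Finset.card_range]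
    _ ≤ _ := Finset.card_le_card hsub
    _ ≤ _ := Finset.card_image_le

/-! ### The form -/

/-- The coordinates of `v`, extended by zero to `ℕ`. -/
def extend (v : V D) (n : ℕ) : ZMod 2 :=
  if h : n ∈ Finset.Icc 1 D then v ⟨n, h⟩ else 0

theorem extend_coe (v : V D) (i : Finset.Icc 1 D) : extend v i = v i := dif_pos i.2

theorem form_eq_sum (v w : V D) :
    form D v w = ∑ i, v i * (extend w ((i : ℕ) - 1) + extend w ((i : ℕ) + 1)) := by
  rw [form, Matrix.toBilin'_apply]
  refine Finset.sum_congr rfl fun i _ => ?_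
  simp only [Matrix.of_apply, mul_assoc, ← Finset.mul_sum]
  congr 1
  have hi := Finset.mem_Icc.1 i.2
  have hext : ∀ n, extend w n = ∑ j : Finset.Icc 1 D, if n = j then w j else 0 := by
    intro n
    by_cases h : n ∈ Finset.Icc 1 D
    · rw [Finset.sum_eq_single ⟨n, h⟩]
      · simp [extend, h]
      · exact fun j _ hj => if_neg fun h' => hj (Subtype.ext h'.symm)
      · simp
    · rw [extend, dif_neg h, Finset.sum_eq_zero]
      intro j _
      refine if_neg fun h' => h ?_
      rw [h']
      exact j.2
  rw [hext, hext, ← Finset.sum_add_distrib]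
  refine Finset.sum_congr rfl fun j _ => ?_
  have hj := Finset.mem_Icc.1 j.2
  by_cases h1 : (i : ℕ) + 1 = j
  · rw [if_pos (Or.inl h1), if_pos h1, if_neg (by omega), one_mul, zero_add]
  · by_cases h2 : (j : ℕ) + 1 = i
    · rw [if_pos (Or.inr h2), if_neg h1, if_pos (by omega), one_mul, add_zero]
    · rw [if_neg (by tauto), if_neg h1, if_neg (by omega), zero_mul, add_zero]

theorem form_comm (v w : V D) : form D v w = form D w v := by
  rw [form, Matrix.toBilin'_apply, Matrix.toBilin'_apply, Finset.sum_comm]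
  refine Finset.sum_congr rfl fun i _ => Finset.sum_congr rfl fun j _ => ?_
  simp only [Matrix.of_apply, or_comm]
  ring

theorem form_isRefl : (form D).IsRefl := fun v w h => by rw [form_comm, h]

theorem form_self (v : V D) : form D v v = 0 := by
  rw [form, Matrix.toBilin'_apply, ← Fintype.sum_prod_type']
  refine Finset.sum_involution (fun p _ => p.swap) (fun p _ => ?_) (fun p _ hp h => ?_)
    (fun _ _ => Finset.mem_univ _) fun p _ => p.swap_swap
  · simp only [Matrix.of_apply, Prod.fst_swap, Prod.snd_swap, or_comm (a := (p.2 : ℕ) + 1 = p.1)]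
    rw [mul_right_comm (v p.2), mul_comm (v p.2), mul_right_comm (v p.1)]
    exact CharTwo.add_self_eq_zero _
  · have : p.2 = p.1 := congrArg Prod.fst h
    exact hp (by simp [this])

theorem form_nondegenerate (hD : Even D) : (form D).Nondegenerate := by
  refine (LinearMap.IsRefl.nondegenerate_iff_separatingRight form_isRefl).2 fun w hw => ?_
  have hrec : ∀ n, 1 ≤ n → n ≤ D → extend w (n - 1) = extend w (n + 1) := by
    intro n h1 h2
    have h := hw (e D ⟨n, Finset.mem_Icc.2 ⟨h1, h2⟩⟩)
    rw [form_eq_sum, Finset.sum_eq_single ⟨n, Finset.mem_Icc.2 ⟨h1, h2⟩⟩] at h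
    · simpa [e, CharTwo.add_eq_zero] using h
    · intro j _ hj
      simp [e, hj]
    · simp
  -- The zero values of `extend` at `0` and `D + 1` start the two recursions. As `D + 1` is odd, the
  -- second one reaches the odd coordinates.
  have heven : ∀ k, 2 * k ≤ D → extend w (2 * k) = 0 := by
    intro k
    induction k with
    | zero => exact fun _ => dif_neg (by simp)
    | succ k ih =>
      intro hk
      exact (hrec (2 * k + 1) (by omega) (by omega)).symm.trans (ih (by omega))
  have hodd : ∀ k, 2 * k ≤ D → extend w (D + 1 - 2 * k) = 0 := by
    intro k
    induction k with
    | zero => exact fun _ => dif_neg (by simp)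
    | succ k ih =>
      intro hk
      have h := hrec (D - 2 * k) (by omega) (by omega)
      rw [show D + 1 - 2 * (k + 1) = D - 2 * k - 1 by omega, h,
        show D - 2 * k + 1 = D + 1 - 2 * k by omega]
      exact ih (by omega)
  ext i
  have hi := Finset.mem_Icc.1 i.2
  obtain ⟨m, hm⟩ := hD
  rw [← extend_coe w i, Pi.zero_apply]
  rcases Nat.even_or_odd' (i : ℕ) with ⟨k, hk | hk⟩
  · rw [hk]
    exact heven k (by omega)
  · rw [show (i : ℕ) = D + 1 - 2 * (m - k) by omega]
    exact hodd (m - k) (by omega)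

theorem extend_eSum_pts (hB : B ∈ S D) (hI : I ∈ B) (n : ℕ) :
    extend (eSum D I.pts) n = if n ∈ I.pts then 1 else 0 := by
  have hb := bounds_of_mem hB hI
  unfold extend
  split_ifs with h1 h2 h2
  · rw [eSum_apply, if_pos h2]
  · rw [eSum_apply, if_neg h2]
  · rw [mem_pts] at h2
    rw [Finset.mem_Icc] at h1
    omega
  · rfl

/-- Each point of `I` has both of its neighbours in `J` or neither, and `1 + 1 = 0`. -/
theorem form_eSum_pts_of_prec_or_apart (hB : B ∈ S D) (hI : I ∈ B) (hJ : J ∈ B)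
    (h : Prec I J ∨ Apart I J) : form D (eSum D I.pts) (eSum D J.pts) = 0 := by
  rw [form_eq_sum]
  refine Finset.sum_eq_zero fun i _ => ?_
  rw [eSum_apply]
  by_cases hi : (i : ℕ) ∈ I.pts
  · have hb := bounds_of_mem hB hI
    have h1 := mem_pts.1 hi
    rw [if_pos hi, one_mul, extend_eSum_pts hB hJ, extend_eSum_pts hB hJ]
    rcases h with ⟨h2, h3⟩ | h
    · rw [if_pos (mem_pts.2 (by omega)), if_pos (mem_pts.2 (by omega))]
      exact CharTwo.add_self_eq_zero _
    · unfold Apart at h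
      rw [if_neg (by rw [mem_pts]; omega), if_neg (by rw [mem_pts]; omega), add_zero]
  · rw [if_neg hi, zero_mul]

theorem form_eq_zero_of_mem_spanB (hB : B ∈ S D) {v w : V D} (hv : v ∈ spanB D B)
    (hw : w ∈ spanB D B) : form D v w = 0 := by
  have hgen : ∀ I ∈ B, ∀ J ∈ B, form D (eSum D I.pts) (eSum D J.pts) = 0 := by
    intro I hI J hJ
    rcases hB.2.1 I hI J hJ with rfl | h | h | h
    · exact form_self _
    · exact form_eSum_pts_of_prec_or_apart hB hI hJ (Or.inr h)
    · exact form_eSum_pts_of_prec_or_apart hB hI hJ (Or.inl h)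
    · rw [form_comm]
      exact form_eSum_pts_of_prec_or_apart hB hJ hI (Or.inl h)
  refine Submodule.span_induction₂ (p := fun v w _ _ => form D v w = 0) ?_ ?_ ?_ ?_ ?_ ?_ ?_ hv hw
  · rintro _ _ ⟨I, hI, rfl⟩ ⟨J, hJ, rfl⟩
    exact hgen I hI J hJ
  all_goals intros; simp_all

theorem form_eq_zero_of_mem_Vpart {v w : V D} (hv : v ∈ Vpart D δ) (hw : w ∈ Vpart D δ) :
    form D v w = 0 := by
  rw [form, Matrix.toBilin'_apply]
  refine Finset.sum_eq_zero fun i _ => Finset.sum_eq_zero fun j _ => ?_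
  by_cases hi : v i = 0
  · rw [hi, zero_mul, zero_mul]
  by_cases hj : w j = 0
  · rw [hj, mul_zero]
  have h := natCast_eq_natCast_iff_mod.1
    ((mem_Vpart.1 hv i hi).trans (mem_Vpart.1 hw j hj).symm)
  rw [Matrix.of_apply, if_neg (by omega), mul_zero, zero_mul]

/-! ### The operation `𝓛 ↦ 𝓛^!` -/

variable {L L' : Submodule (ZMod 2) (V D)}

theorem mem_shriek {v : V D} :
    v ∈ shriek D δ L ↔ v ∈ Vpart D (1 - δ) ∧ ∀ w ∈ L, form D v w = 0 := Iff.rfl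

theorem shriek_anti (h : L ≤ L') : shriek D δ L' ≤ shriek D δ L :=
  fun _ hv => ⟨hv.1, fun w hw => hv.2 w (h hw)⟩

theorem Vpart_sup_Vpart_one_sub : Vpart D δ ⊔ Vpart D (1 - δ) = ⊤ := by
  rcases eq_zero_or_one δ with rfl | rfl
  · rw [sub_zero, Vpart_zero_sup_Vpart_one]
  · rw [sub_self, sup_comm, Vpart_zero_sup_Vpart_one]

/-- This reduces to the double orthogonal: `V_D^δ` is isotropic, so only the component of opposite
parity matters for orthogonality to `L`. -/
theorem shriek_shriek (hD : Even D) (hL : L ≤ Vpart D δ) :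
    shriek D (1 - δ) (shriek D δ L) = L := by
  refine le_antisymm (fun v hv => ?_) fun v hv =>
    ⟨by rw [sub_sub_cancel]; exact hL hv, fun w hw => by rw [form_comm]; exact hw.2 v hv⟩
  rw [mem_shriek, sub_sub_cancel] at hv
  rw [← LinearMap.BilinForm.orthogonal_orthogonal (form_nondegenerate hD) form_isRefl L,
    LinearMap.BilinForm.mem_orthogonal_iff]
  intro w hw
  rw [LinearMap.BilinForm.mem_orthogonal_iff] at hw
  obtain ⟨w₁, h₁, w₂, h₂, rfl⟩ := Submodule.mem_sup.1
    (show w ∈ Vpart D δ ⊔ Vpart D (1 - δ) by rw [Vpart_sup_Vpart_one_sub]; trivial)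
  have hw₂ : w₂ ∈ shriek D δ L := ⟨h₂, fun u hu => by
    have := hw u hu
    rw [map_add, form_eq_zero_of_mem_Vpart (hL hu) h₁, zero_add] at this
    rw [form_comm, this]⟩
  rw [map_add, LinearMap.add_apply, form_eq_zero_of_mem_Vpart h₁ hv.1, form_comm, hv.2 w₂ hw₂,
    add_zero]

theorem part_le_Vpart : part D δ B ≤ Vpart D δ := inf_le_right

theorem shriek_one_shriek_zero_part (hD : Even D) :
    shriek D 1 (shriek D 0 (part D 0 B)) = part D 0 B := by
  have := shriek_shriek (L := part D 0 B) hD part_le_Vpart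
  rwa [sub_zero] at this

theorem part_one_le_shriek (hB : B ∈ S D) : part D 1 B ≤ shriek D 0 (part D 0 B) :=
  fun _ hv => ⟨by rw [sub_zero]; exact hv.2, fun _ hw => form_eq_zero_of_mem_spanB hB hv.1 hw.1⟩

/-- The span is isotropic by (P₀), and `D / 2` independent blocks make it Lagrangian. -/
theorem orthogonal_spanB_of_card (hD : Even D) (hB : B ∈ S D) (hcard : D / 2 ≤ B.card) :
    (form D).orthogonal (spanB D B) = spanB D B := by
  refine (Submodule.eq_of_le_of_finrank_le
    (fun v hv => LinearMap.BilinForm.mem_orthogonal_iff.2 fun w hw =>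
      form_eq_zero_of_mem_spanB hB hw hv) ?_).symm
  rw [LinearMap.BilinForm.finrank_orthogonal (form_nondegenerate hD)]
  have h1 := card_le_finrank_spanB hB
  have h2 : Module.finrank (ZMod 2) (V D) = D := by simp
  obtain ⟨m, hm⟩ := hD
  omega

theorem shriek_zero_part_of_card (hD : Even D) (hB : B ∈ S D) (hcard : D / 2 ≤ B.card) :
    shriek D 0 (part D 0 B) = part D 1 B := by
  refine le_antisymm (fun v hv => ?_) (part_one_le_shriek hB)
  rw [mem_shriek, sub_zero] at hv
  refine ⟨?_, hv.1⟩
  rw [← orthogonal_spanB_of_card hD hB hcard]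
  refine LinearMap.BilinForm.mem_orthogonal_iff.2 fun w hw => ?_
  rw [← part_zero_sup_part_one hB] at hw
  obtain ⟨w₀, h₀, w₁, h₁, rfl⟩ := Submodule.mem_sup.1 hw
  rw [form_comm, map_add, hv.2 w₀ h₀, form_eq_zero_of_mem_Vpart hv.1 h₁.2, add_zero]

theorem shriek_zero_part_one_mem_C (hD : Even D) (hB : B ∈ S D) :
    shriek D 0 (part D 0 (one B)) ∈ C D 1 := by
  have h1 := one_mem_S hB
  have hC : completion D (one B) ∈ S D := completion_mem_S h1 fun I hI => by
    obtain ⟨hIB, h | ⟨J, hJ, hIJ⟩⟩ := (mem_one hB).1 hI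
    · exact Or.inl h
    · rcases eq_zero_or_one (kappa I) with h0 | h0
      -- The parent must itself survive in `¹B`, which is clear for an odd one.
      · obtain ⟨K, hK, hK1, hIK, -⟩ := exists_odd_parent hB hIB h0 hJ hIJ
        exact Or.inr ⟨K, (mem_one hB).2 ⟨hK, Or.inl hK1⟩, hIK⟩
      · exact Or.inl h0
  exact ⟨_, hC, by
    rw [← part_zero_completion h1 hC, shriek_zero_part_of_card hD hC (card_completion hC)]⟩

/-! ### Pairs in `𝓐` and members of the fibre -/

theorem disjoint_Vpart : Disjoint (Vpart D 0) (Vpart D 1) := by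
  refine Submodule.disjoint_def.2 fun v h0 h1 => ?_
  ext i
  by_contra h
  exact zero_ne_one ((mem_Vpart.1 h0 i h).symm.trans (mem_Vpart.1 h1 i h))

theorem eq_and_eq_of_sup_eq {M₀ M₁ N₀ N₁ : Submodule (ZMod 2) (V D)} (hM₀ : M₀ ≤ Vpart D 0)
    (hM₁ : M₁ ≤ Vpart D 1) (hN₀ : N₀ ≤ Vpart D 0) (hN₁ : N₁ ≤ Vpart D 1)
    (h : M₀ ⊔ M₁ = N₀ ⊔ N₁) : M₀ = N₀ ∧ M₁ = N₁ := by
  have key : ∀ {M N : Submodule (ZMod 2) (V D)}, M ≤ Vpart D 0 → N ≤ Vpart D 1 →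
      (M ⊔ N) ⊓ Vpart D 0 = M ∧ (M ⊔ N) ⊓ Vpart D 1 = N := by
    intro M N hM hN
    constructor
    · rw [sup_inf_assoc_of_le N hM, (disjoint_Vpart.symm.mono_left hN).eq_bot, sup_bot_eq]
    · rw [sup_comm, sup_inf_assoc_of_le M hN, (disjoint_Vpart.mono_left hM).eq_bot, sup_bot_eq]
  exact ⟨by rw [← (key hM₀ hM₁).1, h, (key hN₀ hN₁).1],
    by rw [← (key hM₀ hM₁).2, h, (key hN₀ hN₁).2]⟩

/-- Comparing parity components of `𝓛 ⊕ 𝓛'^! = ⟨B⟩` gives `𝓛 = ⟨B⟩_1` and `𝓛'^! = ⟨B⟩_0`; the second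
is then inverted by `shriek_shriek`. -/
theorem part_eq_of_mem_A (hD : Even D) (h : (L, L') ∈ A D) :
    ∃ B ∈ fibre D L, L' = shriek D 0 (part D 0 B) := by
  obtain ⟨⟨B₁, -, hL⟩, ⟨B₂, -, hL'⟩, -, B, hB, hsup⟩ := h
  dsimp only at hL hL' hsup
  rw [sup_comm, ← part_zero_sup_part_one hB] at hsup
  obtain ⟨h0, h1⟩ := eq_and_eq_of_sup_eq (fun v hv => by simpa using (mem_shriek.1 hv).1)
    (hL ▸ part_le_Vpart) part_le_Vpart part_le_Vpart hsup
  refine ⟨B, ⟨hB, h1.symm⟩, ?_⟩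
  have := shriek_shriek (δ := 1) (L := L') hD (hL' ▸ part_le_Vpart)
  rw [← h0]
  rwa [sub_self, eq_comm] at this

theorem shriek_mem_A (hD : Even D) (hB : B ∈ S D) :
    (part D 1 B, shriek D 0 (part D 0 (one B))) ∈ A D := by
  have h1 := one_mem_S hB
  refine ⟨⟨B, hB, rfl⟩, shriek_zero_part_one_mem_C hD hB, ?_, one B, h1, ?_⟩
  · rw [← part_one_one hB]
    exact part_one_le_shriek h1
  · dsimp only
    rw [shriek_one_shriek_zero_part hD, ← part_one_one hB, sup_comm, part_zero_sup_part_one h1]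

theorem card_le_of_le (h : L ≤ L') : Nat.card L ≤ Nat.card L' :=
  Nat.card_le_card_of_injective _ (Submodule.inclusion_injective h)

theorem eq_of_le_of_card_le (h : L ≤ L') (hcard : Nat.card L' ≤ Nat.card L) : L = L' :=
  SetLike.coe_injective (Set.eq_of_subset_of_ncard_le h hcard (Set.toFinite _))

end AlmostSpecial

open AlmostSpecial in
theorem mainTheorem4 (D : ℕ) (hD : Even D)
    (L : Submodule (ZMod 2) (AlmostSpecial.V D)) (hL : L ∈ AlmostSpecial.C D 1) :
    -- a unique `𝓛'` of maximal size
    (∃! L' : Submodule (ZMod 2) (AlmostSpecial.V D),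
      (L' ∈ AlmostSpecial.C D 1 ∧ (L, L') ∈ AlmostSpecial.A D) ∧
      ∀ L'' ∈ AlmostSpecial.C D 1, (L, L'') ∈ AlmostSpecial.A D →
        Nat.card L'' ≤ Nat.card L') ∧
    -- a unique `B'` with `|⟨B'⟩_0^!|` maximal
    (∃! B' : Finset AlmostSpecial.Interval, B' ∈ AlmostSpecial.fibre D L ∧
      ∀ B'' ∈ AlmostSpecial.fibre D L,
        Nat.card (AlmostSpecial.shriek D 0 (AlmostSpecial.part D 0 B'')) ≤
          Nat.card (AlmostSpecial.shriek D 0 (AlmostSpecial.part D 0 B'))) ∧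
    -- a unique `B'` with `dim ⟨B'⟩_0` minimal
    (∃! B' : Finset AlmostSpecial.Interval, B' ∈ AlmostSpecial.fibre D L ∧
      ∀ B'' ∈ AlmostSpecial.fibre D L,
        Module.finrank (ZMod 2) (AlmostSpecial.part D 0 B') ≤
          Module.finrank (ZMod 2) (AlmostSpecial.part D 0 B'')) ∧
    -- in both cases it is `¹B`, for any `B ∈ S_D` with `⟨B⟩_1 = 𝓛`
    (∀ B ∈ AlmostSpecial.S D, AlmostSpecial.part D 1 B = L →
      AlmostSpecial.one B ∈ AlmostSpecial.fibre D L ∧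
      ∀ B'' ∈ AlmostSpecial.fibre D L,
        Nat.card (AlmostSpecial.shriek D 0 (AlmostSpecial.part D 0 B'')) ≤
          Nat.card (AlmostSpecial.shriek D 0 (AlmostSpecial.part D 0 (AlmostSpecial.one B))) ∧
        Module.finrank (ZMod 2) (AlmostSpecial.part D 0 (AlmostSpecial.one B)) ≤
          Module.finrank (ZMod 2) (AlmostSpecial.part D 0 B'')) := by
  obtain ⟨B₀, hB₀, rfl⟩ := hL
  have hfib : ∀ B ∈ S D, part D 1 B = part D 1 B₀ → one B ∈ fibre D (part D 1 B₀) :=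
    fun B hB h => ⟨one_mem_S hB, (part_one_one hB).trans h⟩
  have hle : ∀ B ∈ S D, part D 1 B = part D 1 B₀ → ∀ B'' ∈ fibre D (part D 1 B₀),
      part D 0 (one B) ≤ part D 0 B'' :=
    fun B hB h B'' hB'' => part_zero_one_le hB hB''.1 (h.trans hB''.2.symm)
  have huniq : ∀ B'' ∈ fibre D (part D 1 B₀), part D 0 (one B₀) = part D 0 B'' → B'' = one B₀ :=
    fun B'' hB'' h => eq_of_part_eq hB''.1 (one_mem_S hB₀) h.symm
      (hB''.2.trans (part_one_one hB₀).symm)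
  refine ⟨⟨shriek D 0 (part D 0 (one B₀)),
      ⟨⟨shriek_zero_part_one_mem_C hD hB₀, shriek_mem_A hD hB₀⟩, ?_⟩, ?_⟩,
    ⟨one B₀, ⟨hfib B₀ hB₀ rfl, ?_⟩, ?_⟩, ⟨one B₀, ⟨hfib B₀ hB₀ rfl, ?_⟩, ?_⟩, ?_⟩
  · intro L'' _ hA
    obtain ⟨B, hB, rfl⟩ := part_eq_of_mem_A hD hA
    exact card_le_of_le (shriek_anti (hle B₀ hB₀ rfl B hB))
  · rintro L'' ⟨⟨-, hA⟩, hmax⟩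
    obtain ⟨B, hB, rfl⟩ := part_eq_of_mem_A hD hA
    exact eq_of_le_of_card_le (shriek_anti (hle B₀ hB₀ rfl B hB))
      (hmax _ (shriek_zero_part_one_mem_C hD hB₀) (shriek_mem_A hD hB₀))
  · exact fun B'' hB'' => card_le_of_le (shriek_anti (hle B₀ hB₀ rfl B'' hB''))
  · rintro B'' ⟨hB'', hmax⟩
    refine huniq B'' hB'' ?_
    have := eq_of_le_of_card_le (shriek_anti (δ := 0) (hle B₀ hB₀ rfl B'' hB''))
      (hmax _ (hfib B₀ hB₀ rfl))
    -- Equal cardinality only gives equality of the spaces `⟨·⟩_0^!`; a second `!` recovers the even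
    -- parts.
    rw [← shriek_one_shriek_zero_part hD, ← this, shriek_one_shriek_zero_part hD]
  · exact fun B'' hB'' => Submodule.finrank_mono (hle B₀ hB₀ rfl B'' hB'')
  · rintro B'' ⟨hB'', hmin⟩
    exact huniq B'' hB'' (Submodule.eq_of_le_of_finrank_le (hle B₀ hB₀ rfl B'' hB'')
      (hmin _ (hfib B₀ hB₀ rfl)))
  · exact fun B hB h => ⟨hfib B hB h, fun B'' hB'' =>
      ⟨card_le_of_le (shriek_anti (hle B hB h B'' hB'')),
        Submodule.finrank_mono (hle B hB h B'' hB'')⟩⟩
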